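/- Let $\mathrm{R}$ be a real closed field, with $\mathrm{R}^n$ carrying the product of the order topologies. A polynomial $P\in \mathrm{R}[X_1,\dots,X_n]$ is called multi-affine if $\deg_{X_i}P\le 1$ for every $1\le i\le n$, and $Z(P,\mathrm{R}^n)$ denotes its set of zeros in $\mathrm{R}^n$. A semi-algebraic set is semi-algebraically connected if it is not the disjoint union of two non-empty semi-algebraic sets that are both closed in it; the semi-algebraically connected component of a point $x$ in a semi-algebraic set $S$ is the union of all semi-algebraically connected semi-algebraic subsets of $S$ that contain $x$. Let $d\ge 1$ be an integer. Then for every $n$ and every multi-affine polynomial $P\in \mathrm{R}[X_1,\dots,X_n]$ of total degree at most $d$, the set $Z(P,\mathrm{R}^n)$ has at most $2^{d-1}$ semi-algebraically connected components. This bound, which does not depend on $n$, is sharp: for every $n\ge d$ the polynomial $P=X_1\cdots X_d-1\in \mathrm{R}[X_1,\dots,X_n]$ is multi-affine of total degree at most $d$, and $Z(P,\mathrm{R}^n)$ has exactly $2^{d-1}$ semi-algebraically connected components. -/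

import Mathlib

/-- Semi-algebraic subsets of `R ^ n`: the Boolean combinations of the sets `{x | P x ≥ 0}`,
with `P` a polynomial over the ordered field `R`. -/
inductive IsSemialgebraic {R : Type*} [Field R] [LinearOrder R] {n : ℕ} :
    Set (Fin n → R) → Prop
  | nonneg (P : MvPolynomial (Fin n) R) : IsSemialgebraic {x | 0 ≤ MvPolynomial.eval x P}
  | compl {A : Set (Fin n → R)} : IsSemialgebraic A → IsSemialgebraic Aᶜ
  | inter {A B : Set (Fin n → R)} :
      IsSemialgebraic A → IsSemialgebraic B → IsSemialgebraic (A ∩ B)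

/-- A semi-algebraic set `S` is semi-algebraically connected if it is not the disjoint union of
two non-empty semi-algebraic sets that are both closed in `S`. (The topology of `R ^ n` is the
product of the order topologies.) -/
def IsSemialgebraicallyConnected {R : Type*} [Field R] [LinearOrder R] [TopologicalSpace R]
    {n : ℕ} (S : Set (Fin n → R)) : Prop :=
  IsSemialgebraic S ∧
    ∀ A B : Set (Fin n → R), IsSemialgebraic A → IsSemialgebraic B →
      A ∪ B = S → Disjoint A B →
      IsClosed ((↑) ⁻¹' A : Set S) → IsClosed ((↑) ⁻¹' B : Set S) →
      A = ∅ ∨ B = ∅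

/-- The semi-algebraically connected component of `x` in `S`: the union of all
semi-algebraically connected (semi-algebraic) subsets of `S` that contain `x`. Over a real closed
field, and for `S` semi-algebraic and `x ∈ S`, this is the largest such subset, and it is the
member containing `x` of the partition of `S` into finitely many semi-algebraically connected
sets that are open and closed in `S`. -/
def semialgebraicComponentIn {R : Type*} [Field R] [LinearOrder R] [TopologicalSpace R]
    {n : ℕ} (S : Set (Fin n → R)) (x : Fin n → R) : Set (Fin n → R) :=
  ⋃₀ {C | C ⊆ S ∧ IsSemialgebraicallyConnected C ∧ x ∈ C}

/-- The number of semi-algebraically connected components of `S`, possibly `⊤`. -/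
noncomputable def numSemialgebraicComponents {R : Type*} [Field R] [LinearOrder R]
    [TopologicalSpace R] {n : ℕ} (S : Set (Fin n → R)) : ℕ∞ :=
  (semialgebraicComponentIn S '' S).encard

/-- The set `Z(P, R ^ n)` of zeros of `P` in `R ^ n`. -/
def zeroSet {R : Type*} [Field R] {n : ℕ} (P : MvPolynomial (Fin n) R) : Set (Fin n → R) :=
  {x | MvPolynomial.eval x P = 0}

/-- The set of multi-affine polynomials in `R[X_1, …, X_n]` (degree at most `1` in each variable)
of total degree at most `d`. -/
def multiAffine (R : Type*) [Field R] (d n : ℕ) : Set (MvPolynomial (Fin n) R) :=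
  {P | (∀ i, P.degreeOf i ≤ 1) ∧ P.totalDegree ≤ d}

/-! Put `A = ∂P/∂Xᵢ`, chosen not identically zero; if no such `i` exists, `P` is constant and there
is at most one component. Then `P = Xᵢ A + B` with `A`, `B` free of `Xᵢ`, and over `{A ≠ 0}` the
zero set is the graph `Xᵢ = -B / A`. Every zero of `P` can be moved inside the zero set to a point
where `A ≠ 0` (`exists_semialgebraicallyLinked_pderiv_ne_zero`), and paths in `{A ≠ 0}` lift to the
graph (`SignConnected.lift_zeroSet`). So the components of `Z(P)` are no more numerous than those of
`{A ≠ 0}`, where `A` has degree at most `d - 1`.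

It remains to bound the components of a complement `{P ≠ 0}` by `2 ^ d`
(`exists_card_le_signConnected`), by induction on `d`. A point of `{P > 0}` can be moved off `{A =
0}`, and paths in `{A ≠ 0}` lift to `{P > 0}` by taking `Xᵢ` large with the sign of `A`. Thus `{P >
0}` and, by symmetry, `{P < 0}` have at most `2 ^ (d - 1)` components each.

Paths here are chains of changes of one coordinate. A multi-affine polynomial is affine along such a
step, so equal signs at both ends exclude a zero in between, and the lift of a step to `Z(P)` is an
arc of a hyperbola or a segment. As `R` may be disconnected in its order topology, the connectedness
of these arcs rests on the intermediate value theorem for polynomials, obtained from Galois theory.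
-/

/-! ### Real closed fields: irreducible polynomials and intermediate values -/

open Polynomial in
theorem IsRealClosed.finrank_eq_one_of_odd {R : Type*} [Field R] [IsRealClosed R] [CharZero R]
    (F : Type*) [Field F] [Algebra R F] [FiniteDimensional R F]
    (h : Odd (Module.finrank R F)) : Module.finrank R F = 1 := by
  obtain ⟨α, hα⟩ := Field.exists_primitive_element R F
  have hint : IsIntegral R α := IsIntegral.of_finite R α
  have hdeg : Module.finrank R F = (minpoly R α).natDegree := by
    rw [← IntermediateField.adjoin.finrank hint, hα, IntermediateField.finrank_top']
  rw [hdeg] at h ⊢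
  obtain ⟨r, hr⟩ := IsRealClosed.exists_isRoot_of_odd_natDegree h
  exact natDegree_eq_of_degree_eq_some
    (degree_eq_one_of_irreducible_of_root (minpoly.irreducible hint) hr)

/-- The usual formula for complex square roots: with `m = √(a² + b²)`, take `c² = (m + a) / 2` and
`d² = (m - a) / 2`. Then `2cd = ±b`, and the sign is absorbed into `d`. -/
theorem IsRealClosed.exists_sq_eq_add_mul {R : Type*} [Field R] [LinearOrder R]
    [IsStrictOrderedRing R] [IsRealClosed R] {K : Type*} [Field K] [Algebra R K]
    {i : K} (hi : i ^ 2 = -1) (a b : R) :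
    ∃ c d : R, (algebraMap R K c + algebraMap R K d * i) ^ 2
      = algebraMap R K a + algebraMap R K b * i := by
  obtain ⟨m, hm⟩ := IsSquare.of_nonneg (R := R) (x := a ^ 2 + b ^ 2) (by positivity)
  wlog hm0 : 0 ≤ m generalizing m
  · exact this (-m) (by linarith [hm, neg_mul_neg m m]) (by linarith)
  have h2 : -m ≤ a ∧ a ≤ m :=
    abs_le.mp (abs_le_of_sq_le_sq (by nlinarith [sq_nonneg b]) hm0)
  obtain ⟨c, hc⟩ := IsSquare.of_nonneg (R := R) (x := (m + a) / 2) (by linarith)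
  obtain ⟨d, hd⟩ := IsSquare.of_nonneg (R := R) (x := (m - a) / 2) (by linarith)
  have hcd : (2 * c * d - b) * (2 * c * d + b) = 0 := by
    have : 4 * (c * c) * (d * d) = b ^ 2 := by rw [← hc, ← hd]; linear_combination -hm
    linear_combination this
  have hac : c * c - d * d = a := by rw [← hc, ← hd]; ring
  have key : ∀ d' : R, d' * d' = d * d → 2 * c * d' = b →
      (algebraMap R K c + algebraMap R K d' * i) ^ 2
      = algebraMap R K a + algebraMap R K b * i := by
    intro d' h1 h2
    rw [← h1] at hac
    rw [← hac, ← h2]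
    simp only [map_sub, map_mul, map_ofNat]
    linear_combination (algebraMap R K d') ^ 2 * hi
  rcases mul_eq_zero.mp hcd with h | h
  · exact ⟨c, d, key d rfl (by linarith)⟩
  · exact ⟨c, -d, key (-d) (by ring) (by linarith)⟩

theorem IsRealClosed.exists_eq_add_mul_of_mem_adjoin {R : Type*} [Field R] {K : Type*} [Field K]
    [Algebra R K] {i : K} (hi : i ^ 2 = -1) {x : K} (hx : x ∈ IntermediateField.adjoin R {i}) :
    ∃ a b : R, x = algebraMap R K a + algebraMap R K b * i := by
  have hint : IsIntegral R i :=
    ⟨Polynomial.X ^ 2 + 1, by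
      simpa using Polynomial.monic_X_pow_add_C (1 : R) (two_ne_zero), by simp [hi]⟩
  rw [← IntermediateField.mem_toSubalgebra,
    IntermediateField.adjoin_simple_toSubalgebra_of_isAlgebraic hint.isAlgebraic] at hx
  induction hx using Algebra.adjoin_induction with
  | mem x hx => exact ⟨0, 1, by simpa using hx⟩
  | algebraMap r => exact ⟨r, 0, by simp⟩
  | add x y _ _ h1 h2 =>
    obtain ⟨a, b, rfl⟩ := h1
    obtain ⟨c, d, rfl⟩ := h2
    exact ⟨a + c, b + d, by simp only [map_add]; ring⟩
  | mul x y _ _ h1 h2 =>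
    obtain ⟨a, b, rfl⟩ := h1
    obtain ⟨c, d, rfl⟩ := h2
    refine ⟨a * c - b * d, a * d + b * c, ?_⟩
    simp only [map_add, map_sub, map_mul]
    linear_combination (algebraMap R K b * algebraMap R K d) * hi

/-- A finite Galois extension of a real closed field that contains a square root of `-1` is
generated by it. -/
theorem IsRealClosed.adjoin_eq_top_of_sq_eq_neg_one {R : Type*} [Field R] [LinearOrder R]
    [IsStrictOrderedRing R] [IsRealClosed R] {K : Type*} [Field K] [Algebra R K]
    [FiniteDimensional R K] [IsGalois R K] {i : K} (hi : i ^ 2 = -1) :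
    IntermediateField.adjoin R {i} = ⊤ := by
  have h2 : Fact (Nat.Prime 2) := ⟨Nat.prime_two⟩
  -- The fixed field of a Sylow 2-subgroup has odd degree over `R`, hence equals `R`, so the Sylow
  -- subgroup is the whole group.
  have hG : IsPGroup 2 Gal(K/R) := by
    obtain ⟨H⟩ : Nonempty (Sylow 2 Gal(K/R)) := inferInstance
    have hodd : Odd (Module.finrank R (IntermediateField.fixedField (H : Subgroup Gal(K/R)))) := by
      have := H.not_dvd_index
      rwa [← IntermediateField.fixingSubgroup_fixedField (H : Subgroup Gal(K/R)),
        ← IntermediateField.finrank_eq_fixingSubgroup_index, ← even_iff_two_dvd,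
        Nat.not_even_iff_odd] at this
    have := IsRealClosed.finrank_eq_one_of_odd _ hodd
    have hbot := IntermediateField.finrank_eq_one_iff.mp this
    have htop : (H : Subgroup Gal(K/R)) = ⊤ := by
      rw [← IntermediateField.fixingSubgroup_fixedField (H : Subgroup Gal(K/R)), hbot,
        IntermediateField.fixingSubgroup_bot]
    have := H.isPGroup'
    rw [htop] at this
    exact this.of_equiv Subgroup.topEquiv
  set C := IntermediateField.adjoin R {i} with hC
  have hP := hG.to_subgroup C.fixingSubgroup
  obtain ⟨k, hk⟩ := IsPGroup.iff_card.mp hP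
  rcases k with _ | k
  · have : C.fixingSubgroup = ⊥ := Subgroup.card_eq_one.mp (by simpa using hk)
    rw [← IsGalois.fixedField_fixingSubgroup C, this, IntermediateField.fixedField_bot]
  exfalso
  -- A nontrivial 2-group has a subgroup of index 2; its fixed field would be a quadratic extension
  -- of `R(i)`. None exists, since every element of `R(i)` is a square and the quadratic formula
  -- applies.
  obtain ⟨H, hH⟩ := Sylow.exists_subgroup_card_pow_prime (G := C.fixingSubgroup) 2 (n := k)
    (by rw [hk]; exact pow_dvd_pow 2 (Nat.le_succ k))
  set H' := H.map C.fixingSubgroup.subtype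
  have hcard : Nat.card H' = 2 ^ k := by
    rw [← hH]
    exact Subgroup.card_map_of_injective C.fixingSubgroup.subtype_injective
  have hle : C ≤ IntermediateField.fixedField H' := by
    rw [IntermediateField.le_iff_le]
    rintro _ ⟨g, -, rfl⟩
    exact g.2
  have hf1 : Module.finrank (IntermediateField.fixedField H') K = 2 ^ k := by
    rw [IntermediateField.finrank_fixedField_eq_card, hcard]
  have hf2 : Module.finrank C K = 2 ^ (k + 1) := by
    rw [← IsGalois.card_fixingSubgroup_eq_finrank, hk]
  set E := IntermediateField.extendScalars hle with hE
  have hf3 : Module.finrank C E = 2 := by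
    have h1 : Module.finrank E K = 2 ^ k := hf1
    have h2 := Module.finrank_mul_finrank C E K
    rw [h1, hf2, pow_succ'] at h2
    exact Nat.eq_of_mul_eq_mul_right (by positivity) h2
  have hsq : ∀ x : C, ∃ y : C, y ^ 2 = x := by
    intro x
    obtain ⟨a, b, hab⟩ := IsRealClosed.exists_eq_add_mul_of_mem_adjoin hi x.2
    obtain ⟨c, d, hcd⟩ := IsRealClosed.exists_sq_eq_add_mul hi a b
    refine ⟨algebraMap R C c + algebraMap R C d * ⟨i, IntermediateField.mem_adjoin_simple_self R i⟩,
      Subtype.ext ?_⟩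
    rw [hab, ← hcd]
    rfl
  have hbot : E = ⊥ := by
    refine eq_bot_iff.mpr fun x hx => ?_
    have hdeg := minpoly.natDegree_le (A := C) (⟨x, hx⟩ : E)
    rw [hf3] at hdeg
    set p := minpoly C (⟨x, hx⟩ : E) with hp
    have hp0 : p ≠ 0 := minpoly.ne_zero (IsIntegral.of_finite _ _)
    have hpx : Polynomial.aeval x p = 0 := by
      have := congrArg (algebraMap E K) (minpoly.aeval C (⟨x, hx⟩ : E))
      rwa [← Polynomial.aeval_algebraMap_apply, map_zero] at this
    rw [IntermediateField.mem_bot]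
    obtain ⟨y, hy⟩ := hsq (p.coeff 1 ^ 2 - 4 * p.coeff 2 * p.coeff 0)
    have hpx' : algebraMap C K (p.coeff 2) * x ^ 2 + algebraMap C K (p.coeff 1) * x
        + algebraMap C K (p.coeff 0) = 0 := by
      rw [Polynomial.aeval_eq_sum_range' (Nat.lt_succ_of_le hdeg)] at hpx
      simp only [Finset.sum_range_succ, Finset.sum_range_zero, Algebra.smul_def] at hpx
      linear_combination hpx
    have hy' := congrArg (algebraMap C K) hy
    simp only [map_pow, map_sub, map_mul, map_ofNat] at hy'
    by_cases h2 : p.coeff 2 = 0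
    · by_cases h1 : p.coeff 1 = 0
      · exfalso
        refine hp0 (Polynomial.ext fun m => ?_)
        have h0 : p.coeff 0 = 0 := by simpa [h1, h2] using hpx'
        rcases m with _ | _ | _ | m
        · exact h0
        · exact h1
        · exact h2
        · exact Polynomial.coeff_eq_zero_of_natDegree_lt (by omega)
      · refine ⟨-p.coeff 0 / p.coeff 1, ?_⟩
        have h1' : algebraMap C K (p.coeff 1) ≠ 0 := by simpa using h1
        rw [map_div₀, div_eq_iff h1', map_neg]
        rw [h2, map_zero] at hpx'
        linear_combination -hpx'
    · have h2' : 2 * algebraMap C K (p.coeff 2) ≠ 0 := by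
        have : (2 : K) ≠ 0 := by
          rw [← map_ofNat (algebraMap R K) 2, ← map_zero (algebraMap R K)]
          exact (algebraMap R K).injective.ne two_ne_zero
        exact mul_ne_zero this (by simpa using h2)
      have : (2 * algebraMap C K (p.coeff 2) * x + algebraMap C K (p.coeff 1)
          - algebraMap C K y) * (2 * algebraMap C K (p.coeff 2) * x + algebraMap C K (p.coeff 1)
          + algebraMap C K y) = 0 := by
        linear_combination 4 * algebraMap C K (p.coeff 2) * hpx' - hy'
      rcases mul_eq_zero.mp this with h | h
      · refine ⟨(y - p.coeff 1) / (2 * p.coeff 2), ?_⟩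
        rw [map_div₀, map_mul, map_ofNat, div_eq_iff h2', map_sub]
        linear_combination -h
      · refine ⟨(-y - p.coeff 1) / (2 * p.coeff 2), ?_⟩
        rw [map_div₀, map_mul, map_ofNat, div_eq_iff h2', map_sub, map_neg]
        linear_combination -h
  rw [hbot, IntermediateField.finrank_bot] at hf3
  omega

-- The factor `X ^ 2 + 1` puts a square root of `-1` into the splitting field, which is therefore
-- generated by it and has degree at most 2; it also contains a root of `f`.
open Polynomial in
theorem IsRealClosed.natDegree_le_two_of_irreducible {R : Type*} [Field R] [LinearOrder R]
    [IsStrictOrderedRing R] [IsRealClosed R] {f : R[X]} (hf : Irreducible f) :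
    f.natDegree ≤ 2 := by
  have hne : f * (X ^ 2 + 1) ≠ 0 :=
    mul_ne_zero hf.ne_zero (by simpa using (monic_X_pow_add_C (1 : R) two_ne_zero).ne_zero)
  let K := (f * (X ^ 2 + 1)).SplittingField
  have : Normal R K := Normal.of_isSplittingField (f * (X ^ 2 + 1))
  have : IsGalois R K := ⟨⟩
  have hsp : ((f * (X ^ 2 + 1)).map (algebraMap R K)).Splits := SplittingField.splits _
  have hroot : ∀ g : R[X], g ∣ f * (X ^ 2 + 1) → g.degree ≠ 0 → ∃ α : K, aeval α g = 0 := by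
    intro g hg hg0
    obtain ⟨α, hα⟩ := (hsp.of_dvd ((Polynomial.map_ne_zero_iff (algebraMap R K).injective).mpr hne)
      (Polynomial.map_dvd (algebraMap R K) hg)).exists_eval_eq_zero (by rwa [degree_map])
    exact ⟨α, by rwa [eval_map_algebraMap] at hα⟩
  obtain ⟨i, hi⟩ := hroot (X ^ 2 + 1) (dvd_mul_left _ _)
    (by rw [← C_1, degree_X_pow_add_C two_pos]; decide)
  obtain ⟨α, hα⟩ := hroot f (dvd_mul_right _ _) (degree_pos_of_irreducible hf).ne'
  have hi' : i ^ 2 = -1 := by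
    simp only [map_add, map_pow, aeval_X, map_one] at hi
    linear_combination hi
  have htop := IsRealClosed.adjoin_eq_top_of_sq_eq_neg_one (R := R) hi'
  have hint : IsIntegral R i := IsIntegral.of_finite R i
  have hK : Module.finrank R K ≤ 2 := by
    rw [← IntermediateField.finrank_top', ← htop, IntermediateField.adjoin.finrank hint]
    refine (natDegree_le_of_dvd (minpoly.dvd R i hi) ?_).trans (by compute_degree)
    simpa using (monic_X_pow_add_C (1 : R) two_ne_zero).ne_zero
  rw [natDegree_eq_of_degree_eq (degree_eq_degree_of_associated
    ((minpoly.irreducible (IsIntegral.of_finite R α)).associated_of_dvd hf (minpoly.dvd R α hα))).symm]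
  exact (minpoly.natDegree_le α).trans hK

-- If there is no root in `[a, b]`, each irreducible factor has the same sign at `a` and `b`: a
-- linear one because its root lies outside, a quadratic one because its discriminant is negative.
-- Hence so does the product.
open Polynomial in
theorem IsRealClosed.exists_isRoot_of_eval_mul_neg {R : Type*} [Field R] [LinearOrder R]
    [IsStrictOrderedRing R] [IsRealClosed R] (p : R[X]) {a b : R} (hab : a ≤ b)
    (h : p.eval a * p.eval b < 0) : ∃ c, a ≤ c ∧ c ≤ b ∧ p.IsRoot c := by
  by_contra! hno
  refine absurd h (not_lt.mpr (le_of_lt ?_))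
  clear h
  have hp : p ≠ 0 := by
    rintro rfl
    exact hno a le_rfl hab (by simp)
  induction p using WfDvdMonoid.induction_on_irreducible with
  | zero => exact absurd rfl hp
  | unit u hu =>
    obtain ⟨c, hc, rfl⟩ := Polynomial.isUnit_iff.mp hu
    simpa using hc.ne_zero
  | mul q p hq0 hp' ih =>
    have h1 := ih (fun c h1 h2 h3 => hno c h1 h2 (by simp [h3.eq_zero, IsRoot])) hq0
    have h2 : ∀ c, a ≤ c → c ≤ b → ¬ p.IsRoot c :=
      fun c h1 h2 h3 => hno c h1 h2 (by simp [h3.eq_zero, IsRoot])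
    have h3 : 0 < p.eval a * p.eval b := by
      have hd := IsRealClosed.natDegree_le_two_of_irreducible hp'
      have hev : ∀ x, p.eval x = p.coeff 2 * x ^ 2 + p.coeff 1 * x + p.coeff 0 := by
        intro x
        rw [eval_eq_sum_range' (Nat.lt_succ_of_le hd)]
        simp only [Finset.sum_range_succ, Finset.sum_range_zero]
        ring
      have hroot : p.coeff 2 ≠ 0 → ∀ x, p.eval x ≠ 0 := fun h x hx => h <|
        coeff_eq_zero_of_degree_lt (by
          rw [degree_eq_one_of_irreducible_of_root hp' hx]; decide)
      have hne : p.coeff 2 = 0 → p.coeff 1 = 0 → p.coeff 0 ≠ 0 := by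
        intro h h' h''
        refine hp'.ne_zero (Polynomial.ext fun m => ?_)
        rcases m with _ | _ | _ | m
        · exact h''
        · exact h'
        · exact h
        · exact coeff_eq_zero_of_natDegree_lt (by omega)
      generalize p.coeff 2 = α, p.coeff 1 = β, p.coeff 0 = γ at hev hroot hne
      simp only [IsRoot, hev] at h2 hroot ⊢
      by_cases hα : α = 0
      · subst hα
        by_cases hβ : β = 0
        · subst hβ
          simpa using hne rfl rfl
        · by_contra! hneg
          have e : β * (-γ / β) = -γ := by field_simp
          have h4 : (-γ / β - a) * (b - -γ / β) * β ^ 2 ≥ 0 := by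
            have : (-γ / β - a) * (b - -γ / β) * β ^ 2
              = (β * (-γ / β) - β * a) * (β * b - β * (-γ / β)) := by ring
            rw [this, e]
            linarith
          have h5 : 0 ≤ (-γ / β - a) * (b - -γ / β) :=
            nonneg_of_mul_nonneg_left h4 (by positivity)
          refine h2 (-γ / β) ?_ ?_ (by linear_combination e)
          · by_contra! h6
            nlinarith
          · by_contra! h6
            nlinarith
      · have hdisc : β ^ 2 - 4 * α * γ < 0 := by
          by_contra! h
          obtain ⟨s, hs⟩ := IsSquare.of_nonneg h
          refine hroot hα ((-β + s) / (2 * α)) ?_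
          field_simp
          linear_combination -hs
        have hpos : ∀ x, 0 < 4 * α * (α * x ^ 2 + β * x + γ) := fun x => by
          nlinarith [sq_nonneg (2 * α * x + β)]
        have h16 := mul_pos (hpos a) (hpos b)
        have : 0 < (4 * α) ^ 2 * ((α * a ^ 2 + β * a + γ) * (α * b ^ 2 + β * b + γ)) := by
          linarith
        exact pos_of_mul_pos_right this (by positivity)
    rw [eval_mul, eval_mul]
    nlinarith [mul_pos h1 h3]

/-! ### Basic semi-algebraic sets -/

section Semialgebraic

variable {R : Type*} [Field R] [LinearOrder R] {n : ℕ}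

theorem IsSemialgebraic.univ [IsStrictOrderedRing R] :
    IsSemialgebraic (Set.univ : Set (Fin n → R)) := by
  simpa using IsSemialgebraic.nonneg (0 : MvPolynomial (Fin n) R)

theorem IsSemialgebraic.nonpos [IsStrictOrderedRing R] (P : MvPolynomial (Fin n) R) :
    IsSemialgebraic {x | MvPolynomial.eval x P ≤ 0} := by
  simpa using IsSemialgebraic.nonneg (-P)

theorem IsSemialgebraic.zeroSet [IsStrictOrderedRing R] (P : MvPolynomial (Fin n) R) :
    IsSemialgebraic (zeroSet P) := by
  convert (IsSemialgebraic.nonneg P).inter (IsSemialgebraic.nonpos P) using 1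
  ext x
  exact ⟨fun h => ⟨h.ge, h.le⟩, fun h => le_antisymm h.2 h.1⟩

theorem IsSemialgebraic.union {A B : Set (Fin n → R)} (hA : IsSemialgebraic A)
    (hB : IsSemialgebraic B) : IsSemialgebraic (A ∪ B) := by
  rw [Set.union_eq_compl_compl_inter_compl]
  exact (hA.compl.inter hB.compl).compl

theorem IsSemialgebraic.biInter [IsStrictOrderedRing R] {ι : Type*} (s : Finset ι)
    {A : ι → Set (Fin n → R)} (hA : ∀ i ∈ s, IsSemialgebraic (A i)) :
    IsSemialgebraic (⋂ i ∈ s, A i) := by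
  classical
  induction s using Finset.induction_on with
  | empty => simpa using IsSemialgebraic.univ
  | insert a s ha ih =>
    rw [Finset.set_biInter_insert]
    exact (hA a (by simp)).inter (ih fun i hi => hA i (by simp [hi]))

theorem IsSemialgebraic.agreeOn [IsStrictOrderedRing R] (s : Finset (Fin n)) (x : Fin n → R) :
    IsSemialgebraic {y : Fin n → R | ∀ j ∈ s, y j = x j} := by
  convert IsSemialgebraic.biInter s (A := fun j => _root_.zeroSet
    (MvPolynomial.X j - MvPolynomial.C (x j))) (fun j _ => IsSemialgebraic.zeroSet _) using 1
  ext y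
  simp [_root_.zeroSet, sub_eq_zero]

theorem IsSemialgebraic.coord_mem_Icc [IsStrictOrderedRing R] (k : Fin n) (u v : R) :
    IsSemialgebraic {y : Fin n → R | y k ∈ Set.Icc u v} := by
  convert (IsSemialgebraic.nonneg (MvPolynomial.X k - MvPolynomial.C u)).inter
    (IsSemialgebraic.nonpos (MvPolynomial.X k - MvPolynomial.C v)) using 1
  ext y
  simp

theorem IsSemialgebraic.singleton [IsStrictOrderedRing R] (x : Fin n → R) :
    IsSemialgebraic {x} := by
  convert IsSemialgebraic.agreeOn Finset.univ x using 1
  ext y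
  simp [funext_iff]

end Semialgebraic

/-! ### Semi-algebraic connectedness and components -/

section Connected

variable {R : Type*} [Field R] [LinearOrder R] [TopologicalSpace R] {n : ℕ}

theorem IsSemialgebraicallyConnected.singleton [IsStrictOrderedRing R] (x : Fin n → R) :
    IsSemialgebraicallyConnected {x} := by
  refine ⟨IsSemialgebraic.singleton x, fun A B _ _ hAB hd _ _ => ?_⟩
  by_contra! h
  obtain ⟨⟨a, ha⟩, ⟨b, hb⟩⟩ := h
  have h1 : a = x := hAB.subset (Or.inl ha)
  have h2 : b = x := hAB.subset (Or.inr hb)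
  subst h1
  subst h2
  exact Set.disjoint_left.mp hd ha hb

theorem IsClosed.preimage_val_inter_of_subset {X : Type*} [TopologicalSpace X] {A S C : Set X}
    (hA : IsClosed ((↑) ⁻¹' A : Set S)) (hC : C ⊆ S) : IsClosed ((↑) ⁻¹' (A ∩ C) : Set C) := by
  have := hA.preimage (continuous_inclusion hC)
  convert this using 1
  ext y
  simp

/-- A partition of `S` into two relatively closed semi-algebraic sets cannot separate a connected
subset of `S`. -/
theorem IsSemialgebraicallyConnected.inter_eq_empty {S A B C : Set (Fin n → R)}
    (hC : IsSemialgebraicallyConnected C) (hCS : C ⊆ S) (hA : IsSemialgebraic A)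
    (hB : IsSemialgebraic B) (hAB : A ∪ B = S) (hd : Disjoint A B)
    (hAc : IsClosed ((↑) ⁻¹' A : Set S)) (hBc : IsClosed ((↑) ⁻¹' B : Set S)) :
    A ∩ C = ∅ ∨ B ∩ C = ∅ := by
  refine hC.2 _ _ (hA.inter hC.1) (hB.inter hC.1) ?_
    (hd.mono Set.inter_subset_left Set.inter_subset_left)
    (hAc.preimage_val_inter_of_subset hCS) (hBc.preimage_val_inter_of_subset hCS)
  rw [← Set.union_inter_distrib_right, hAB, Set.inter_eq_right.mpr hCS]

theorem IsSemialgebraicallyConnected.union {C D : Set (Fin n → R)}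
    (hC : IsSemialgebraicallyConnected C) (hD : IsSemialgebraicallyConnected D)
    {z : Fin n → R} (hzC : z ∈ C) (hzD : z ∈ D) : IsSemialgebraicallyConnected (C ∪ D) := by
  refine ⟨hC.1.union hD.1, fun A B hA hB hAB hd hAc hBc => ?_⟩
  have h1 := hC.inter_eq_empty Set.subset_union_left hA hB hAB hd hAc hBc
  have h2 := hD.inter_eq_empty Set.subset_union_right hA hB hAB hd hAc hBc
  have hz : z ∈ A ∪ B := hAB ▸ Or.inl hzC
  simp only [Set.eq_empty_iff_forall_notMem, Set.mem_inter_iff, not_and] at h1 h2 ⊢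
  have hA' : ∀ y ∈ A, y ∈ C ∨ y ∈ D := fun y hy => hAB.subset (Or.inl hy)
  have hB' : ∀ y ∈ B, y ∈ C ∨ y ∈ D := fun y hy => hAB.subset (Or.inr hy)
  grind

/-- Two points are linked in `S` if some semi-algebraically connected subset of `S` contains both
of them. -/
def SemialgebraicallyLinked (S : Set (Fin n → R)) (x y : Fin n → R) : Prop :=
  ∃ C ⊆ S, IsSemialgebraicallyConnected C ∧ x ∈ C ∧ y ∈ C

theorem SemialgebraicallyLinked.refl [IsStrictOrderedRing R] {S : Set (Fin n → R)}
    {x : Fin n → R} (hx : x ∈ S) : SemialgebraicallyLinked S x x :=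
  ⟨{x}, by simpa using hx, .singleton x, rfl, rfl⟩

theorem SemialgebraicallyLinked.symm {S : Set (Fin n → R)} {x y : Fin n → R}
    (h : SemialgebraicallyLinked S x y) : SemialgebraicallyLinked S y x := by
  obtain ⟨C, h1, h2, h3, h4⟩ := h
  exact ⟨C, h1, h2, h4, h3⟩

theorem SemialgebraicallyLinked.trans {S : Set (Fin n → R)} {x y z : Fin n → R}
    (h : SemialgebraicallyLinked S x y) (h' : SemialgebraicallyLinked S y z) :
    SemialgebraicallyLinked S x z := by
  obtain ⟨C, h1, h2, h3, h4⟩ := h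
  obtain ⟨D, k1, k2, k3, k4⟩ := h'
  exact ⟨C ∪ D, Set.union_subset h1 k1, h2.union k2 h4 k3, Or.inl h3, Or.inr k4⟩

theorem mem_semialgebraicComponentIn_iff {S : Set (Fin n → R)} {x y : Fin n → R} :
    y ∈ semialgebraicComponentIn S x ↔ SemialgebraicallyLinked S x y := by
  simp only [semialgebraicComponentIn, Set.mem_sUnion, Set.mem_ofPred_eq, SemialgebraicallyLinked]
  exact ⟨fun ⟨C, ⟨h1, h2, h3⟩, h4⟩ => ⟨C, h1, h2, h3, h4⟩,
    fun ⟨C, h1, h2, h3, h4⟩ => ⟨C, ⟨h1, h2, h3⟩, h4⟩⟩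

theorem SemialgebraicallyLinked.componentIn_eq {S : Set (Fin n → R)} {x y : Fin n → R}
    (h : SemialgebraicallyLinked S x y) :
    semialgebraicComponentIn S x = semialgebraicComponentIn S y := by
  ext z
  rw [mem_semialgebraicComponentIn_iff, mem_semialgebraicComponentIn_iff]
  exact ⟨h.symm.trans, h.trans⟩

theorem numSemialgebraicComponents_le_card {S : Set (Fin n → R)} (T : Finset (Fin n → R))
    (hT : ∀ x ∈ S, ∃ t ∈ T, SemialgebraicallyLinked S x t) :
    numSemialgebraicComponents S ≤ T.card := by
  have hsub : semialgebraicComponentIn S '' S ⊆ semialgebraicComponentIn S '' T := by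
    rintro _ ⟨x, hx, rfl⟩
    obtain ⟨t, ht, hxt⟩ := hT x hx
    exact ⟨t, ht, hxt.componentIn_eq.symm⟩
  calc numSemialgebraicComponents S ≤ (semialgebraicComponentIn S '' (T : Set _)).encard :=
        Set.encard_le_encard hsub
    _ ≤ (T : Set (Fin n → R)).encard := Set.encard_image_le _ _
    _ = T.card := Set.encard_coe_eq_coe_finsetCard T

end Connected

/-! ### Connectedness of rational arcs -/

section Curves

variable {R : Type*} [Field R] [LinearOrder R]

/-- Away from finitely many points, membership in `T` is locally constant on `[u, v]`. -/
def IsTameOn (u v : R) (T : Set R) : Prop :=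
  ∃ F : Finset R, ∀ a b, u ≤ a → a < b → b ≤ v → (∀ c ∈ F, ¬(a ≤ c ∧ c ≤ b)) → (a ∈ T ↔ b ∈ T)

omit [Field R] in
theorem IsTameOn.compl {u v : R} {T : Set R} (h : IsTameOn u v T) : IsTameOn u v Tᶜ := by
  obtain ⟨F, hF⟩ := h
  exact ⟨F, fun a b h1 h2 h3 h4 => not_congr (hF a b h1 h2 h3 h4)⟩

omit [Field R] in
theorem IsTameOn.inter {u v : R} {T T' : Set R} (h : IsTameOn u v T) (h' : IsTameOn u v T') :
    IsTameOn u v (T ∩ T') := by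
  classical
  obtain ⟨F, hF⟩ := h
  obtain ⟨F', hF'⟩ := h'
  exact ⟨F ∪ F', fun a b h1 h2 h3 h4 => and_congr
    (hF a b h1 h2 h3 fun c hc => h4 c (Finset.mem_union_left _ hc))
    (hF' a b h1 h2 h3 fun c hc => h4 c (Finset.mem_union_right _ hc))⟩

omit [Field R] in
theorem IsTameOn.mono {u v u' v' : R} {T : Set R} (h : IsTameOn u v T) (hu : u ≤ u')
    (hv : v' ≤ v) : IsTameOn u' v' T := by
  obtain ⟨F, hF⟩ := h
  exact ⟨F, fun a b h1 h2 h3 h4 => hF a b (hu.trans h1) h2 (h3.trans hv) h4⟩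

theorem isTameOn_polynomial_nonneg [IsStrictOrderedRing R] [IsRealClosed R] (p : Polynomial R)
    (u v : R) : IsTameOn u v {s | 0 ≤ p.eval s} := by
  by_cases hp : p = 0
  · exact ⟨∅, by simp [hp]⟩
  refine ⟨p.roots.toFinset, fun a b _ hab _ hF => ?_⟩
  have hno : ∀ c, a ≤ c → c ≤ b → ¬ p.IsRoot c := fun c h1 h2 h3 =>
    hF c (by simpa [hp] using h3) ⟨h1, h2⟩
  have h : ¬ p.eval a * p.eval b < 0 := fun h => by
    obtain ⟨c, h1, h2, h3⟩ := IsRealClosed.exists_isRoot_of_eval_mul_neg p hab.le h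
    exact hno c h1 h2 h3
  have ha : p.eval a ≠ 0 := hno a le_rfl hab.le
  have hb : p.eval b ≠ 0 := hno b hab.le le_rfl
  simp only [Set.mem_ofPred_eq]
  constructor
  · intro h1
    by_contra! h2
    exact h (mul_neg_of_pos_of_neg (h1.lt_of_ne' ha) h2)
  · intro h1
    by_contra! h2
    exact h (mul_neg_of_neg_of_pos h2 (h1.lt_of_ne' hb))

/-- The order topology may be disconnected, but a tame set cannot separate an interval: between
exceptional points it contains everything or nothing, and closedness carries this to the endpoints.
-/
theorem IsTameOn.right_mem_of_isClosed [IsStrictOrderedRing R] [TopologicalSpace R]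
    [OrderTopology R] {u v : R} {T T' : Set R} (hT : IsTameOn u v T) (huv : u ≤ v)
    (hc : IsClosed T) (hc' : IsClosed T') (hd : Disjoint T T') (hun : Set.Icc u v ⊆ T ∪ T')
    (hu : u ∈ T) : v ∈ T := by
  classical
  obtain ⟨F, hF⟩ := hT
  induction hm : (F.filter fun c => u < c ∧ c < v).card using Nat.strong_induction_on
    generalizing u v with
  | h m ih =>
    rcases huv.eq_or_lt with rfl | huv'
    · exact hu
    -- Cutting at an interior exceptional point leaves fewer of them on each side.
    by_cases hex : ∃ f ∈ F, u < f ∧ f < v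
    · obtain ⟨f, hf, h1, h2⟩ := hex
      have hfT : f ∈ T := by
        refine ih _ ?_ h1.le (fun x hx => hun ⟨hx.1, hx.2.trans h2.le⟩) hu
          (fun a b ha hab hb => hF a b ha hab (hb.trans h2.le)) rfl
        rw [← hm]
        refine Finset.card_lt_card (Finset.ssubset_iff_subset_ne.mpr ⟨?_, fun he => ?_⟩)
        · intro c
          simp only [Finset.mem_filter]
          exact fun h => ⟨h.1, h.2.1, h.2.2.trans h2⟩
        · have : f ∈ F.filter fun c => u < c ∧ c < v := by simp [hf, h1, h2]
          rw [← he] at this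
          simp at this
      refine ih _ ?_ h2.le (fun x hx => hun ⟨h1.le.trans hx.1, hx.2⟩) hfT
        (fun a b ha hab hb => hF a b (h1.le.trans ha) hab hb) rfl
      rw [← hm]
      refine Finset.card_lt_card (Finset.ssubset_iff_subset_ne.mpr ⟨?_, fun he => ?_⟩)
      · intro c
        simp only [Finset.mem_filter]
        exact fun h => ⟨h.1, h1.trans h.2.1, h.2.2⟩
      · have : f ∈ F.filter fun c => u < c ∧ c < v := by simp [hf, h1, h2]
        rw [← he] at this
        simp at this
    · push Not at hex
      have hconst : ∀ a b, u < a → a < b → b < v → (a ∈ T ↔ b ∈ T) := fun a b ha hab hb =>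
        hF a b ha.le hab hb.le fun c hcF h =>
          absurd (hex c hcF (ha.trans_le h.1)) (not_le.mpr (h.2.trans_lt hb))
      obtain ⟨c, hc1, hc2⟩ := exists_between huv'
      have hall : ∀ a, u < a → a < v → (a ∈ T ↔ c ∈ T) := fun a h1 h2 => by
        rcases lt_trichotomy a c with h | rfl | h
        · exact hconst a c h1 h hc2
        · rfl
        · exact (hconst c a hc1 h h2).symm
      by_cases hcT : c ∈ T
      · have : Set.Icc u v ⊆ T := by
          rw [← closure_Ioo huv'.ne]
          exact hc.closure_subset_iff.mpr fun a ha => (hall a ha.1 ha.2).mpr hcT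
        exact this ⟨huv, le_rfl⟩
      · have : Set.Icc u v ⊆ T' := by
          rw [← closure_Ioo huv'.ne]
          exact hc'.closure_subset_iff.mpr fun a ha => (hun ⟨ha.1.le, ha.2.le⟩).resolve_left
            fun h => hcT ((hall a ha.1 ha.2).mp h)
        exact absurd (this ⟨le_rfl, huv⟩) (Set.disjoint_left.mp hd hu)

variable [IsStrictOrderedRing R] {n : ℕ}

-- Clearing denominators: along a curve with coordinates `N j / D`, a polynomial becomes a
-- polynomial in the parameter after multiplication by a power of `D`.
omit [LinearOrder R] [IsStrictOrderedRing R] in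
open Polynomial in
theorem exists_eval_eq_pow_mul_eval {φ : R → Fin n → R} {D : R[X]} {N : Fin n → R[X]} {I : Set R}
    (hφ : ∀ s ∈ I, ∀ j, φ s j * D.eval s = (N j).eval s) (Q : MvPolynomial (Fin n) R) :
    ∃ (q : R[X]) (m : ℕ), ∀ s ∈ I, q.eval s = D.eval s ^ m * MvPolynomial.eval (φ s) Q := by
  induction Q using MvPolynomial.induction_on with
  | C a => exact ⟨C a, 0, by simp⟩
  | add p q hp hq =>
    obtain ⟨p', m, hp⟩ := hp
    obtain ⟨q', l, hq⟩ := hq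
    refine ⟨D ^ l * p' + D ^ m * q', m + l, fun s hs => ?_⟩
    simp only [eval_add, eval_mul, eval_pow, hp s hs, hq s hs, map_add]
    ring
  | mul_X p j hp =>
    obtain ⟨p', m, hp⟩ := hp
    refine ⟨p' * N j, m + 1, fun s hs => ?_⟩
    simp only [eval_mul, hp s hs, ← hφ s hs j, map_mul, MvPolynomial.eval_X]
    ring

open Polynomial in
theorem IsSemialgebraic.isTameOn_preimage [IsRealClosed R] {φ : R → Fin n → R} {D : R[X]}
    {N : Fin n → R[X]} {u v : R} (hD : ∀ s ∈ Set.Icc u v, D.eval s ≠ 0)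
    (hφ : ∀ s ∈ Set.Icc u v, ∀ j, φ s j * D.eval s = (N j).eval s) {A : Set (Fin n → R)}
    (hA : IsSemialgebraic A) : IsTameOn u v (φ ⁻¹' A) := by
  induction hA with
  | nonneg Q =>
    obtain ⟨q, m, hq⟩ := exists_eval_eq_pow_mul_eval hφ Q
    -- The second factor `D ^ m` makes the multiplier a nonzero square, so the sign of `D` is
    -- irrelevant.
    obtain ⟨F, hF⟩ := isTameOn_polynomial_nonneg (D ^ m * q) u v
    have key : ∀ s ∈ Set.Icc u v, 0 ≤ (D ^ m * q).eval s ↔ 0 ≤ MvPolynomial.eval (φ s) Q := by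
      intro s hs
      rw [eval_mul, eval_pow, hq s hs, ← mul_assoc]
      have : D.eval s ^ m ≠ 0 := pow_ne_zero _ (hD s hs)
      exact mul_nonneg_iff_of_pos_left (mul_self_pos.mpr this)
    refine ⟨F, fun a b h1 h2 h3 h4 => ?_⟩
    have := hF a b h1 h2 h3 h4
    simp only [Set.mem_ofPred_eq] at this
    rwa [key a ⟨h1, h2.le.trans h3⟩, key b ⟨h1.trans h2.le, h3⟩] at this
  | compl _ ih => exact ih.compl
  | inter _ _ ih ih' => exact ih.inter ih'

open Polynomial in
/-- The image of a closed interval under a curve with rational coordinates is semi-algebraically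
connected, if it is semi-algebraic. -/
theorem IsSemialgebraic.isSemialgebraicallyConnected_image_Icc [IsRealClosed R]
    [TopologicalSpace R] [OrderTopology R] {φ : R → Fin n → R} {D : R[X]}
    {N : Fin n → R[X]} {u v : R} (hD : ∀ s ∈ Set.Icc u v, D.eval s ≠ 0)
    (hφ : ∀ s ∈ Set.Icc u v, ∀ j, φ s j * D.eval s = (N j).eval s)
    (hS : IsSemialgebraic (φ '' Set.Icc u v)) :
    IsSemialgebraicallyConnected (φ '' Set.Icc u v) := by
  have hcont : ContinuousOn φ (Set.Icc u v) := by
    refine continuousOn_pi.mpr fun j => ?_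
    have h1 : ContinuousOn (fun s => (N j).eval s / D.eval s) (Set.Icc u v) :=
      (N j).continuous.continuousOn.div D.continuous.continuousOn hD
    exact h1.congr fun s hs => by
      simp only [← hφ s hs j, mul_div_cancel_right₀ _ (hD s hs)]
  have hclosed : ∀ A : Set (Fin n → R), IsClosed ((↑) ⁻¹' A : Set (φ '' Set.Icc u v)) →
      IsClosed (Set.Icc u v ∩ φ ⁻¹' A) := by
    intro A hA
    obtain ⟨C, hC, hCA⟩ := isClosed_induced_iff.mp hA
    convert hcont.preimage_isClosed_of_isClosed isClosed_Icc hC using 1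
    ext s
    refine and_congr_right fun hs => ?_
    have := congrArg (fun B => (⟨φ s, s, hs, rfl⟩ : φ '' Set.Icc u v) ∈ B) hCA
    simpa using this.symm
  have key : ∀ A B : Set (Fin n → R), IsSemialgebraic A →
      A ∪ B = φ '' Set.Icc u v → Disjoint A B →
      IsClosed ((↑) ⁻¹' A : Set (φ '' Set.Icc u v)) →
      IsClosed ((↑) ⁻¹' B : Set (φ '' Set.Icc u v)) →
      ∀ s t, u ≤ s → s ≤ t → t ≤ v → φ s ∈ A → φ t ∈ A := by
    intro A B hA hAB hd hAc hBc s t hs hst ht hsA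
    have htame : IsTameOn s t (Set.Icc u v ∩ φ ⁻¹' A) := by
      obtain ⟨F, hF⟩ := (hA.isTameOn_preimage hD hφ).mono hs ht
      refine ⟨F, fun a b h1 h2 h3 h4 => ?_⟩
      have h5 : a ∈ Set.Icc u v := ⟨hs.trans h1, h2.le.trans (h3.trans ht)⟩
      have h6 : b ∈ Set.Icc u v := ⟨hs.trans (h1.trans h2.le), h3.trans ht⟩
      simpa [-Set.mem_Icc, h5, h6] using hF a b h1 h2 h3 h4
    refine (htame.right_mem_of_isClosed hst (hclosed A hAc) (hclosed B hBc) ?_ ?_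
      ⟨⟨hs, hst.trans ht⟩, hsA⟩).2
    · exact Set.disjoint_left.mpr fun a ha hb => Set.disjoint_left.mp hd ha.2 hb.2
    · intro a ha
      have h5 : a ∈ Set.Icc u v := ⟨hs.trans ha.1, ha.2.trans ht⟩
      have : φ a ∈ A ∪ B := hAB ▸ ⟨a, h5, rfl⟩
      exact this.imp (fun h => ⟨h5, h⟩) (fun h => ⟨h5, h⟩)
  refine ⟨hS, fun A B hA hB hAB hd hAc hBc => ?_⟩
  by_contra! h
  obtain ⟨⟨a, ha⟩, ⟨b, hb⟩⟩ := h
  obtain ⟨s, hs, rfl⟩ : a ∈ φ '' Set.Icc u v := hAB ▸ Or.inl ha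
  obtain ⟨t, ht, rfl⟩ : b ∈ φ '' Set.Icc u v := hAB ▸ Or.inr hb
  rcases le_total s t with hst | hst
  · exact Set.disjoint_left.mp hd (key A B hA hAB hd hAc hBc s t hs.1 hst ht.2 ha) hb
  · exact Set.disjoint_left.mp hd ha
      (key B A hB (Set.union_comm A B ▸ hAB) hd.symm hBc hAc t s ht.1 hst hs.2 hb)

end Curves

/-! ### Multi-affine polynomials and the complement of their zero set -/

section MultiAffine

open Function MvPolynomial

/-- A reflexive transitive relation that contains all changes of a single coordinate is total. -/
theorem rel_of_rel_update {X : Type*} {n : ℕ} {r : (Fin n → X) → (Fin n → X) → Prop} (hr : ∀ x, r x x)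
    (ht : ∀ x y z, r x y → r y z → r x z) (hu : ∀ x i v, r x (update x i v)) (x y : Fin n → X) :
    r x y := by
  have : ∀ s : Finset (Fin n), r x (s.piecewise y x) := by
    intro s
    induction s using Finset.induction_on with
    | empty => simpa using hr x
    | insert a s _ ih =>
      rw [Finset.piecewise_insert]
      exact ht _ _ _ ih (hu _ _ _)
  simpa using this Finset.univ

variable {R : Type*} [Field R] {n d : ℕ}

theorem neg_mem_multiAffine {P : MvPolynomial (Fin n) R} (hP : P ∈ multiAffine R d n) :
    -P ∈ multiAffine R d n := by
  refine ⟨fun i => ?_, ?_⟩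
  · rw [degreeOf_neg]
    exact hP.1 i
  · rw [totalDegree_neg]
    exact hP.2

theorem pderiv_mem_multiAffine {P : MvPolynomial (Fin n) R} (hP : P ∈ multiAffine R (d + 1) n)
    (i : Fin n) : pderiv i P ∈ multiAffine R d n := by
  have hsupp : ∀ m ∈ (pderiv i P).support, m + Finsupp.single i 1 ∈ P.support := by
    intro m hm
    rw [mem_support_iff, coeff_pderiv] at hm
    exact mem_support_iff.mpr (left_ne_zero_of_mul hm)
  refine ⟨fun j => degreeOf_le_iff.mpr fun m hm => ?_, Finset.sup_le fun m hm => ?_⟩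
  · have := monomial_le_degreeOf j (hsupp m hm)
    rw [Finsupp.add_apply] at this
    have := hP.1 j
    omega
  · have h1 := (le_totalDegree (hsupp m hm)).trans hP.2
    rw [Finsupp.sum_add_index' (by simp) (by simp), Finsupp.sum_single_index rfl] at h1
    omega

theorem eval_update_of_mem_multiAffine {P : MvPolynomial (Fin n) R} (hP : P ∈ multiAffine R d n)
    (x : Fin n → R) (i : Fin n) (v : R) :
    eval (update x i v) P = eval x P + (v - x i) * eval x (pderiv i P) := by
  rw [P.as_sum]
  simp only [map_sum, Finset.mul_sum, ← Finset.sum_add_distrib]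
  refine Finset.sum_congr rfl fun m hm => ?_
  have hmi : m i ≤ 1 := (monomial_le_degreeOf i hm).trans (hP.1 i)
  have key : ∀ (m : Fin n →₀ ℕ) (y : Fin n → R), m.prod (fun j e => y j ^ e)
      = y i ^ m i * ∏ j ∈ Finset.univ.erase i, y j ^ m j := fun m y => by
    rw [Finsupp.prod_fintype _ _ (by simp), Finset.mul_prod_erase _ (fun j => y j ^ m j)
      (Finset.mem_univ i)]
  have h1 : ∏ j ∈ Finset.univ.erase i, update x i v j ^ m j
      = ∏ j ∈ Finset.univ.erase i, x j ^ m j :=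
    Finset.prod_congr rfl fun j hj => by rw [update_of_ne (Finset.ne_of_mem_erase hj)]
  have h2 : ∏ j ∈ Finset.univ.erase i, x j ^ (m - Finsupp.single i 1 : Fin n →₀ ℕ) j
      = ∏ j ∈ Finset.univ.erase i, x j ^ m j :=
    Finset.prod_congr rfl fun j hj => by
      rw [Finsupp.tsub_apply, Finsupp.single_eq_of_ne (Finset.ne_of_mem_erase hj), Nat.sub_zero]
  rw [pderiv_monomial, eval_monomial, eval_monomial, eval_monomial, key, key, key, h1, h2,
    update_self, Finsupp.tsub_apply, Finsupp.single_eq_same]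
  interval_cases m i
  · simp
  · simp; ring

/-- `P` is affine in `Xᵢ`, so its slope is the same from every base point of the line; the values at
`v` and `v + 1` are compared. -/
theorem eval_update_pderiv_self [CharZero R] {P : MvPolynomial (Fin n) R}
    (hP : P ∈ multiAffine R d n) (x : Fin n → R) (i : Fin n) (v : R) :
    eval (update x i v) (pderiv i P) = eval x (pderiv i P) := by
  have h1 := eval_update_of_mem_multiAffine hP x i v
  have h2 := eval_update_of_mem_multiAffine hP x i (v + 1)
  have h3 := eval_update_of_mem_multiAffine hP (update x i v) i (v + 1)
  rw [update_idem, update_self] at h3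
  linear_combination h2 - h3 - h1

variable [LinearOrder R]

/-- `x` and `y` are joined by a sequence of changes of single coordinates along which `P` keeps
its (strict) sign. -/
def SignConnected (P : MvPolynomial (Fin n) R) : (Fin n → R) → (Fin n → R) → Prop :=
  Relation.ReflTransGen fun x y => ∃ i v, y = update x i v ∧ 0 < eval x P * eval y P

theorem SignConnected.neg {P : MvPolynomial (Fin n) R} {x y : Fin n → R}
    (h : SignConnected (-P) x y) : SignConnected P x y := by
  refine Relation.ReflTransGen.mono (fun a b => ?_) _ _ h
  rintro ⟨i, v, h1, h2⟩
  exact ⟨i, v, h1, by simpa using h2⟩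

variable [IsStrictOrderedRing R]

/-- Any small positive `ε` keeps the first expression positive, and a nonzero affine function of `ε`
vanishes at most once, so one of two small candidates works. -/
theorem exists_pos_add_mul_and_add_mul_ne_zero {p q c a : R} (hp : 0 < p) (h : c ≠ 0 ∨ a ≠ 0) :
    ∃ ε, 0 < p + ε * q ∧ c + ε * a ≠ 0 := by
  have hq : 0 < |q| + 1 := by positivity
  have hδ : 0 < p / (|q| + 1) := by positivity
  have hpos : ∀ ε, 0 < ε → ε ≤ p / (|q| + 1) → 0 < p + ε * q := by
    intro ε h1 h2
    have h3 := (le_div_iff₀ hq).mp h2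
    nlinarith [neg_abs_le q]
  by_cases h1 : c + p / (|q| + 1) * a = 0
  · refine ⟨p / (|q| + 1) / 2, hpos _ (by linarith) (by linarith), fun h2 => ?_⟩
    have hc : c = 0 := by linarith
    have ha : p / (|q| + 1) * a = 0 := by linarith
    exact h.elim (fun h => h hc) fun h => (mul_ne_zero hδ.ne' h) ha
  · exact ⟨_, hpos _ hδ le_rfl, h1⟩

/-- Inside `{P > 0}` every point can be moved off the zero set of a non-vanishing multi-affine
polynomial. -/
theorem exists_signConnected_eval_ne_zero {e : ℕ} {P A : MvPolynomial (Fin n) R}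
    (hP : P ∈ multiAffine R d n) (hA : A ∈ multiAffine R e n) {x z : Fin n → R}
    (hx : 0 < eval x P) (hz : eval z A ≠ 0) :
    ∃ y, SignConnected P x y ∧ 0 < eval y P ∧ eval y A ≠ 0 := by
  -- The hybrid point has the coordinates of `y` on `s` and those of `z` elsewhere. Each coordinate
  -- is nudged before it is adopted, so that `A` stays nonzero at the hybrid.
  have : ∀ s : Finset (Fin n), ∃ y, SignConnected P x y ∧ 0 < eval y P ∧
      eval (s.piecewise y z) A ≠ 0 := by
    intro s
    induction s using Finset.induction_on with
    | empty => exact ⟨x, Relation.ReflTransGen.refl, hx, by simpa using hz⟩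
    | insert i s his ih =>
      obtain ⟨y, h1, h2, h3⟩ := ih
      obtain ⟨ε, h4, h5⟩ := exists_pos_add_mul_and_add_mul_ne_zero
        (q := eval y (pderiv i P)) (c := eval (s.piecewise y z) A
          + (y i - z i) * eval (s.piecewise y z) (pderiv i A))
        (a := eval (s.piecewise y z) (pderiv i A)) h2 (by
          by_contra! h
          rw [h.2, mul_zero, add_zero] at h
          exact h3 h.1)
      have h6 : 0 < eval (update y i (y i + ε)) P := by
        rw [eval_update_of_mem_multiAffine hP]
        simpa using h4
      refine ⟨update y i (y i + ε), h1.tail ⟨i, _, rfl, mul_pos h2 h6⟩, h6, ?_⟩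
      have : (insert i s).piecewise (update y i (y i + ε)) z
          = update (s.piecewise y z) i (y i + ε) := by
        ext j
        by_cases hj : j = i
        · subst hj
          simp
        · simp [Finset.piecewise, hj]
      rw [this, eval_update_of_mem_multiAffine hA, Finset.piecewise_eq_of_notMem _ _ _ his]
      convert h5 using 1
      ring
  obtain ⟨y, h1, h2, h3⟩ := this Finset.univ
  exact ⟨y, h1, h2, by simpa using h3⟩

/-- Along direction `i` both restrictions of `P` are affine with slopes of one sign, so both are
positive far enough out on that side. -/
theorem exists_pos_eval_update {P : MvPolynomial (Fin n) R} (hP : P ∈ multiAffine R d n)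
    {i : Fin n} {x y : Fin n → R} (h : 0 < eval x (pderiv i P) * eval y (pderiv i P)) :
    ∃ c, 0 < eval (update x i c) P ∧ 0 < eval (update y i c) P := by
  simp only [eval_update_of_mem_multiAffine hP]
  set a := eval x (pderiv i P)
  set b := eval y (pderiv i P)
  have aux : ∀ p u e c : R, 0 < e → u + (1 + |p|) / e ≤ c → 0 < p + (c - u) * e := by
    intro p u e c he hc
    have : (1 + |p|) / e * e ≤ (c - u) * e := by gcongr; linarith
    rw [div_mul_cancel₀ _ he.ne'] at this
    linarith [neg_abs_le p]
  rcases pos_and_pos_or_neg_and_neg_of_mul_pos h with ⟨ha, hb⟩ | ⟨ha, hb⟩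
  · exact ⟨_, aux _ _ _ _ ha (le_max_left _ _), aux _ _ _ _ hb (le_max_right _ _)⟩
  · have h1 := aux (eval x P) (-x i) (-a) _ (neg_pos.mpr ha)
      (le_max_left _ (-y i + (1 + |eval y P|) / (-b)))
    have h2 := aux (eval y P) (-y i) (-b) _ (neg_pos.mpr hb)
      (le_max_right (-x i + (1 + |eval x P|) / (-a)) _)
    refine ⟨-max (-x i + (1 + |eval x P|) / (-a)) (-y i + (1 + |eval y P|) / (-b)), ?_, ?_⟩
    · linarith
    · linarith

/-- Paths in the complement of the zero set of `∂P/∂Xᵢ` lift to `{P > 0}`. -/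
theorem SignConnected.lift_pos {P : MvPolynomial (Fin n) R} (hP : P ∈ multiAffine R d n)
    {i : Fin n} {y t : Fin n → R} (hy : 0 < eval y P) (h : SignConnected (pderiv i P) y t) :
    ∀ c, 0 < eval (update t i c) P → SignConnected P y (update t i c) := by
  induction h with
  | refl => exact fun c hc => Relation.ReflTransGen.single ⟨i, c, rfl, mul_pos hy hc⟩
  | @tail t _ _ hstep ih =>
    obtain ⟨k, v, rfl, hpos⟩ := hstep
    intro c hc
    by_cases hk : k = i
    · subst hk
      rw [update_idem] at hc ⊢
      exact ih c hc
    -- With coordinate `i` parked at `e`, `P` is positive before and after the change of coordinate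
    -- `k`; coordinate `i` is then moved to `c`.
    · obtain ⟨e, h1, h2⟩ := exists_pos_eval_update hP hpos
      have h3 : update (update t k v) i e = update (update t i e) k v :=
        update_comm hk _ _ _
      refine ((ih e h1).tail ⟨k, v, h3, mul_pos h1 h2⟩).tail ⟨i, c, ?_, mul_pos h2 hc⟩
      rw [update_idem]

theorem signConnected_of_pderiv_eq_zero {P : MvPolynomial (Fin n) R} (hP : P ∈ multiAffine R d n)
    (h : ∀ i x, eval x (pderiv i P) = 0) {x : Fin n → R} (hx : eval x P ≠ 0) (y : Fin n → R) :
    SignConnected P x y ∧ eval y P ≠ 0 := by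
  refine rel_of_rel_update (r := fun x y => eval x P ≠ 0 → SignConnected P x y ∧ eval y P ≠ 0)
    (fun x hx => ⟨Relation.ReflTransGen.refl, hx⟩)
    (fun x y z h1 h2 hx => ⟨(h1 hx).1.trans (h2 (h1 hx).2).1, (h2 (h1 hx).2).2⟩)
    (fun x i v hx => ?_) x y hx
  have : eval (update x i v) P = eval x P := by
    rw [eval_update_of_mem_multiAffine hP, h, mul_zero, add_zero]
  exact ⟨Relation.ReflTransGen.single ⟨i, v, rfl, by rw [this]; exact mul_self_pos.mpr hx⟩,
    by rwa [this]⟩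

/-- The complement of the zero set of a multi-affine polynomial of degree at most `d` has at most
`2 ^ d` sign-connected components. -/
theorem exists_card_le_signConnected {P : MvPolynomial (Fin n) R} (hP : P ∈ multiAffine R d n) :
    ∃ T : Finset (Fin n → R), T.card ≤ 2 ^ d ∧ ∀ x, eval x P ≠ 0 → ∃ t ∈ T, SignConnected P x t := by
  classical
  induction d generalizing P with
  | zero =>
    have hd : ∀ i x, eval x (pderiv i P) = 0 := by
      intro i x
      rw [totalDegree_eq_zero_iff_eq_C.mp (Nat.le_zero.mp hP.2), pderiv_C, map_zero]
    exact ⟨{0}, by simp, fun x hx =>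
      ⟨0, by simp, (signConnected_of_pderiv_eq_zero hP hd hx 0).1⟩⟩
  | succ d ih =>
    by_cases hd : ∀ i x, eval x (pderiv i P) = 0
    · exact ⟨{0}, by simpa using Nat.one_le_two_pow, fun x hx =>
        ⟨0, by simp, (signConnected_of_pderiv_eq_zero hP hd hx 0).1⟩⟩
    push Not at hd
    obtain ⟨i, z, hz⟩ := hd
    have half : ∀ Q : MvPolynomial (Fin n) R, Q ∈ multiAffine R (d + 1) n →
        eval z (pderiv i Q) ≠ 0 → ∃ T : Finset (Fin n → R), T.card ≤ 2 ^ d ∧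
          ∀ x, 0 < eval x Q → ∃ t ∈ T, SignConnected Q x t := by
      intro Q hQ hz
      obtain ⟨T, hT, hcov⟩ := ih (pderiv_mem_multiAffine hQ i)
      choose! c hc using fun (t : Fin n → R) (ht : eval t (pderiv i Q) ≠ 0) =>
        exists_pos_eval_update hQ (mul_self_pos.mpr ht)
      refine ⟨T.image fun t => update t i (c t), Finset.card_image_le.trans hT, fun x hx => ?_⟩
      obtain ⟨y, h1, h2, h3⟩ := exists_signConnected_eval_ne_zero hQ
        (pderiv_mem_multiAffine hQ i) hx hz
      obtain ⟨t, ht, hyt⟩ := hcov y h3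
      have ht0 : eval t (pderiv i Q) ≠ 0 := by
        rcases Relation.ReflTransGen.cases_tail hyt with rfl | ⟨b, -, _, _, -, h⟩
        · exact h3
        · exact right_ne_zero_of_mul h.ne'
      exact ⟨_, Finset.mem_image_of_mem _ ht,
        h1.trans (SignConnected.lift_pos hQ h2 hyt _ (hc t ht0).1)⟩
    obtain ⟨T, hT, h1⟩ := half P hP hz
    obtain ⟨T', hT', h2⟩ := half (-P) (neg_mem_multiAffine hP) (by simpa using hz)
    refine ⟨T ∪ T', (Finset.card_union_le _ _).trans (by rw [pow_succ]; omega), fun x hx => ?_⟩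
    rcases hx.lt_or_gt with h | h
    · obtain ⟨t, ht, hxt⟩ := h2 x (by simpa using h)
      exact ⟨t, Finset.mem_union_right _ ht, hxt.neg⟩
    · obtain ⟨t, ht, hxt⟩ := h1 x h
      exact ⟨t, Finset.mem_union_left _ ht, hxt⟩

end MultiAffine

/-! ### Linking zeros and the upper bound -/

section ZeroSet

open Function MvPolynomial

variable {R : Type*} [Field R] [LinearOrder R] [IsStrictOrderedRing R] [IsRealClosed R]
  [TopologicalSpace R] [OrderTopology R] {n d : ℕ}

/-- Two zeros of `P` that differ in a single coordinate lie on a line of zeros of `P`. -/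
theorem semialgebraicallyLinked_update {P : MvPolynomial (Fin n) R} (hP : P ∈ multiAffine R d n)
    {x : Fin n → R} {k : Fin n} {v : R} (hx : eval x P = 0) (hv : eval (update x k v) P = 0) :
    SemialgebraicallyLinked (zeroSet P) x (update x k v) := by
  by_cases hvk : v = x k
  · subst hvk
    rw [update_eq_self]
    exact SemialgebraicallyLinked.refl hx
  have hp : eval x (pderiv k P) = 0 := by
    rw [eval_update_of_mem_multiAffine hP, hx, zero_add] at hv
    exact (mul_eq_zero.mp hv).resolve_left (sub_ne_zero.mpr hvk)
  set I := Set.Icc (min (x k) v) (max (x k) v) with hI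
  have himage : update x k '' I
      = {y | ∀ j ∈ Finset.univ.erase k, y j = x j} ∩ {y | y k ∈ I} := by
    ext y
    constructor
    · rintro ⟨s, hs, rfl⟩
      refine ⟨fun j hj => update_of_ne (Finset.ne_of_mem_erase hj) _ _, ?_⟩
      simpa using hs
    · rintro ⟨h1, h2⟩
      refine ⟨y k, h2, ?_⟩
      rw [update_eq_iff]
      exact ⟨rfl, fun j hj => (h1 j (by simp [hj])).symm⟩
  refine ⟨update x k '' I, ?_, ?_, ⟨x k, ⟨min_le_left _ _, le_max_left _ _⟩, update_eq_self _ _⟩,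
    ⟨v, ⟨min_le_right _ _, le_max_right _ _⟩, rfl⟩⟩
  · rintro _ ⟨s, -, rfl⟩
    change eval _ P = 0
    rw [eval_update_of_mem_multiAffine hP, hx, hp, mul_zero, add_zero]
  · refine IsSemialgebraic.isSemialgebraicallyConnected_image_Icc (D := 1)
      (N := update (fun j => Polynomial.C (x j)) k Polynomial.X) (by simp) ?_ ?_
    · intro s _ j
      by_cases hj : j = k
      · subst hj
        simp
      · simp [hj]
    · rw [himage]
      exact (IsSemialgebraic.agreeOn _ _).inter (IsSemialgebraic.coord_mem_Icc _ _ _)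

/-- Two zeros of `P` that differ in the coordinates `i` and `k` only lie on the same arc of a
hyperbola if `∂P/∂Xᵢ` has the same sign at both. -/
theorem semialgebraicallyLinked_of_pderiv_mul_pos {P : MvPolynomial (Fin n) R}
    (hP : P ∈ multiAffine R d n) {x y : Fin n → R} {i k : Fin n} (hik : k ≠ i)
    (hx : eval x P = 0) (hy : eval y P = 0) (hxy : ∀ j, j ≠ i → j ≠ k → y j = x j)
    (hpos : 0 < eval x (pderiv i P) * eval y (pderiv i P))
    {e : ℕ} (hA : pderiv i P ∈ multiAffine R e n) :
    SemialgebraicallyLinked (zeroSet P) x y := by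
  wlog hle : x k ≤ y k generalizing x y
  · exact (this hy hx (fun j h1 h2 => (hxy j h1 h2).symm) (by rwa [mul_comm])
      (not_le.mp hle).le).symm
  set p := eval x (pderiv k P)
  set α := eval x (pderiv i P)
  set a := eval x (pderiv k (pderiv i P))
  have hPs : ∀ s, eval (update x k s) P = (s - x k) * p := fun s => by
    rw [eval_update_of_mem_multiAffine hP, hx, zero_add]
  have hAs : ∀ s, eval (update x k s) (pderiv i P) = α + (s - x k) * a := fun s =>
    eval_update_of_mem_multiAffine hA x k s
  have hPst : ∀ s t, eval (update (update x k s) i t) P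
      = (s - x k) * p + (t - x i) * (α + (s - x k) * a) := fun s t => by
    rw [eval_update_of_mem_multiAffine hP, hPs, hAs, update_of_ne hik.symm]
  have hform : ∀ z : Fin n → R, (∀ j, j ≠ i → j ≠ k → z j = x j) →
      z = update (update x k (z k)) i (z i) := by
    intro z hz
    ext j
    by_cases h1 : j = i
    · subst h1
      simp
    · by_cases h2 : j = k
      · subst h2
        simp [h1]
      · simp [h1, h2, hz j h1 h2]
  have hAy : eval y (pderiv i P) = α + (y k - x k) * a := by
    rw [hform y hxy, eval_update_pderiv_self hP, hAs]
    simp [hik]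
  -- The product with `α` is affine in `s` and positive at both ends.
  have hD : ∀ s ∈ Set.Icc (x k) (y k), α + (s - x k) * a ≠ 0 := by
    rintro s ⟨h1, h2⟩
    have hα0 : 0 < α * α := mul_self_pos.mpr (left_ne_zero_of_mul hpos.ne')
    have : 0 < α * (α + (s - x k) * a) := by
      rw [hAy] at hpos
      rcases le_total 0 (α * a) with h | h
      · nlinarith [mul_nonneg (sub_nonneg.mpr h1) h]
      · nlinarith [mul_nonneg (sub_nonneg.mpr h2) (neg_nonneg.mpr h)]
    exact right_ne_zero_of_mul this.ne'
  -- The equation `P = 0` solved for `Xᵢ`, with `X_k = s` as parameter. The solution is unique where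
  -- the denominator is nonzero, so the arc is all of the zero set over the segment; this makes it
  -- semi-algebraic.
  set φ : R → Fin n → R := fun s =>
    update (update x k s) i (x i - (s - x k) * p / (α + (s - x k) * a)) with hφ
  have hφk : ∀ s, φ s k = s := fun s => by simp [hφ, hik]
  have hφz : ∀ s ∈ Set.Icc (x k) (y k), eval (φ s) P = 0 := by
    intro s hs
    rw [hφ, hPst]
    have := hD s hs
    field_simp
    ring
  have hφmem : ∀ z : Fin n → R, (∀ j, j ≠ i → j ≠ k → z j = x j) → z k ∈ Set.Icc (x k) (y k) →
      eval z P = 0 → φ (z k) = z := by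
    intro z hz hzk hPz
    conv_rhs => rw [hform z hz]
    rw [hform z hz, hPst] at hPz
    have := hD _ hzk
    simp only [hφ]
    congr 1
    field_simp
    linear_combination -hPz
  have himage : φ '' Set.Icc (x k) (y k) = {z | ∀ j ∈ (Finset.univ.erase i).erase k, z j = x j} ∩
      {z | z k ∈ Set.Icc (x k) (y k)} ∩ zeroSet P := by
    ext z
    constructor
    · rintro ⟨s, hs, rfl⟩
      refine ⟨⟨fun j hj => ?_, by rw [Set.mem_ofPred_eq, hφk]; exact hs⟩, hφz s hs⟩
      simp only [Finset.mem_erase] at hj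
      simp [hφ, hj.1, hj.2.1]
    · rintro ⟨⟨h1, h2⟩, h3⟩
      exact ⟨z k, h2, hφmem z (fun j h4 h5 => h1 j (by simp [h4, h5])) h2 h3⟩
  refine ⟨φ '' Set.Icc (x k) (y k), ?_, ?_,
    ⟨x k, ⟨le_rfl, hle⟩, hφmem x (fun _ _ _ => rfl) ⟨le_rfl, hle⟩ hx⟩,
    ⟨y k, ⟨hle, le_rfl⟩, hφmem y hxy ⟨hle, le_rfl⟩ hy⟩⟩
  · rintro _ ⟨s, hs, rfl⟩
    exact hφz s hs
  · refine IsSemialgebraic.isSemialgebraicallyConnected_image_Icc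
      (D := .C α + (.X - .C (x k)) * .C a)
      (N := update (update (fun j => .C (x j) * (.C α + (.X - .C (x k)) * .C a)) k
          (.X * (.C α + (.X - .C (x k)) * .C a))) i
        (.C (x i) * (.C α + (.X - .C (x k)) * .C a) - (.X - .C (x k)) * .C p))
      (by simpa using hD) ?_ ?_
    · intro s hs j
      have := hD s hs
      by_cases h1 : j = i
      · subst h1
        simp only [hφ, update_self, Polynomial.eval_add, Polynomial.eval_sub, Polynomial.eval_mul,
          Polynomial.eval_C, Polynomial.eval_X]
        rw [sub_mul, div_mul_cancel₀ _ this]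
      · by_cases h2 : j = k
        · subst h2
          simp [hφ, h1]
        · simp [hφ, h1, h2]
    · rw [himage]
      exact ((IsSemialgebraic.agreeOn _ _).inter (IsSemialgebraic.coord_mem_Icc _ _ _)).inter
        (IsSemialgebraic.zeroSet P)

/-- If `∂P/∂Xᵢ` does not vanish identically, then every zero of the multi-affine polynomial `P`
can be moved inside the zero set to a point at which `∂P/∂Xᵢ` does not vanish. -/
theorem exists_semialgebraicallyLinked_pderiv_ne_zero {P : MvPolynomial (Fin n) R}
    (hP : P ∈ multiAffine R (d + 1) n) {i : Fin n} (K : Finset (Fin n)) (hiK : i ∉ K)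
    {x z : Fin n → R} (hx : eval x P = 0) (hz : eval z (pderiv i P) ≠ 0)
    (hxz : ∀ j, j ≠ i → j ∉ K → z j = x j) :
    ∃ y, SemialgebraicallyLinked (zeroSet P) x y ∧ eval y P = 0 ∧ eval y (pderiv i P) ≠ 0 := by
  have hA := pderiv_mem_multiAffine hP
  -- Besides `i`, only coordinates in `K` may differ between `x` and `z`. Each round makes `x` and
  -- `z` agree in one more coordinate, keeping `P x = 0` and `∂P/∂Xᵢ ≠ 0` at `z`.
  induction hK : K.card generalizing K x z with
  | zero =>
    obtain rfl := Finset.card_eq_zero.mp hK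
    refine ⟨x, SemialgebraicallyLinked.refl hx, hx, ?_⟩
    have : z = update x i (z i) := by
      rw [eq_comm, update_eq_iff]
      exact ⟨rfl, fun j hj => (hxz j hj (by simp)).symm⟩
    rwa [this, eval_update_pderiv_self hP] at hz
  | succ m ih =>
    by_cases hAx : eval x (pderiv i P) ≠ 0
    · exact ⟨x, SemialgebraicallyLinked.refl hx, hx, hAx⟩
    push Not at hAx
    have free : ∀ k ∈ K, eval x (pderiv k P) = 0 → ∃ y,
        SemialgebraicallyLinked (zeroSet P) x y ∧ eval y P = 0 ∧ eval y (pderiv i P) ≠ 0 := by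
      intro k hk hpk
      have h1 : eval (update x k (z k)) P = 0 := by
        rw [eval_update_of_mem_multiAffine hP, hx, hpk, mul_zero, add_zero]
      obtain ⟨y, h2, h3⟩ := ih (K.erase k) (by simp [hiK]) h1 hz (fun j hj hjK => by
        by_cases hjk : j = k
        · subst hjk
          simp
        · rw [update_of_ne hjk]
          exact hxz j hj (by simpa [hjk] using hjK)) (by simp [hk, hK])
      exact ⟨y, (semialgebraicallyLinked_update hP hx h1).trans h2, h3⟩
    obtain ⟨k, hk⟩ : K.Nonempty := Finset.card_pos.mp (by omega)
    have hki : k ≠ i := fun h => hiK (h ▸ hk)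
    by_cases hpk : eval x (pderiv k P) = 0
    · exact free k hk hpk
    by_cases hl : ∃ l ∈ K, l ≠ k
    · obtain ⟨l, hl, hlk⟩ := hl
      by_cases hpl : eval x (pderiv l P) = 0
      · exact free l hl hpl
      have hli : l ≠ i := fun h => hiK (h ▸ hl)
      set p := eval x (pderiv k P)
      set q := eval x (pderiv l P)
      set r := eval x (pderiv k (pderiv l P))
      -- Coordinate `k` of both points becomes `x k + ε`, and coordinate `l` of `x` compensates
      -- along a hyperbola. The choice of `ε` keeps the sign of `∂P/∂X_l` along this move and keeps
      -- `∂P/∂Xᵢ` nonzero at `z`.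
      obtain ⟨ε, h1, h2⟩ := exists_pos_add_mul_and_add_mul_ne_zero
        (p := q * q) (q := q * r)
        (c := eval z (pderiv i P) + (x k - z k) * eval z (pderiv k (pderiv i P)))
        (a := eval z (pderiv k (pderiv i P))) (mul_self_pos.mpr hpl) (by
          by_contra! h
          rw [h.2, mul_zero, add_zero] at h
          exact hz h.1)
      have hq' : q + ε * r ≠ 0 := by
        intro h
        have : q * q + ε * (q * r) = q * (q + ε * r) := by ring
        rw [this, h, mul_zero] at h1
        exact lt_irrefl _ h1
      set x' := update (update x k (x k + ε)) l (x l - ε * p / (q + ε * r)) with hx'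
      have hlx : eval (update x k (x k + ε)) (pderiv l P) = q + ε * r := by
        rw [eval_update_of_mem_multiAffine (hA l)]
        ring
      have h3 : eval x' P = 0 := by
        rw [hx', eval_update_of_mem_multiAffine hP, hlx, eval_update_of_mem_multiAffine hP, hx,
          update_of_ne hlk]
        field_simp
        ring
      have h4 : SemialgebraicallyLinked (zeroSet P) x x' := by
        refine semialgebraicallyLinked_of_pderiv_mul_pos hP hlk.symm hx h3
          (fun j h1 h2 => by simp [hx', h1, h2]) ?_ (hA l)
        rw [hx', eval_update_pderiv_self hP, hlx]
        linarith
      obtain ⟨y, h5, h6⟩ := ih (K.erase k) (z := update z k (x k + ε)) (by simp [hiK]) h3 (by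
          rw [eval_update_of_mem_multiAffine (hA i)]
          convert h2 using 1
          ring) (fun j hj hjK => by
        by_cases hjk : j = k
        · subst hjk
          simp [hx', hlk.symm]
        · have hjK' : j ∉ K := by simpa [hjk] using hjK
          have hjl : j ≠ l := fun h => hjK' (h ▸ hl)
          simp [hx', hjk, hjl, hxz j hj hjK']) (by simp [hk, hK])
      exact ⟨y, h4.trans h5, h6⟩
    -- Now `K = {k}`. In the `(i, k)`-plane through `x`, with displacements `t` and `s`, `P = s (p +
    -- t a)`: two crossing lines. One moves along `s = 0` to the crossing `t = -p / a`, then along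
    -- the other line to `z k`.
    · push Not at hl
      set p := eval x (pderiv k P)
      set a := eval x (pderiv k (pderiv i P))
      have hAv : ∀ v, eval (update x k v) (pderiv i P) = (v - x k) * a := fun v => by
        rw [eval_update_of_mem_multiAffine (hA i), hAx, zero_add]
      have hAz : eval (update x k (z k)) (pderiv i P) ≠ 0 := by
        have : z = update (update x k (z k)) i (z i) := by
          ext j
          by_cases h1 : j = i
          · subst h1
            simp
          · by_cases h2 : j = k
            · subst h2
              simp [h1]
            · simp [h1, h2, hxz j h1 fun h => h2 (hl j h)]
        rwa [this, eval_update_pderiv_self hP] at hz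
      have ha : a ≠ 0 := by
        rw [hAv] at hAz
        exact right_ne_zero_of_mul hAz
      have h1 : ∀ t, eval (update x i t) P = 0 := fun t => by
        rw [eval_update_of_mem_multiAffine hP, hx, hAx, mul_zero, add_zero]
      have h2 : eval (update (update x i (x i - p / a)) k (z k)) P = 0 := by
        rw [update_comm hki.symm, eval_update_of_mem_multiAffine hP, hAv,
          eval_update_of_mem_multiAffine hP, hx, update_of_ne hki.symm]
        field_simp
        ring
      refine ⟨_, (semialgebraicallyLinked_update hP hx (h1 _)).trans
        (semialgebraicallyLinked_update hP (h1 _) h2), h2, ?_⟩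
      rwa [update_comm hki.symm, eval_update_pderiv_self hP]

/-- Paths in the complement of the zero set of `∂P/∂Xᵢ` lift to the zero set of `P`. -/
theorem SignConnected.lift_zeroSet {P : MvPolynomial (Fin n) R} (hP : P ∈ multiAffine R (d + 1) n)
    {i : Fin n} {x t : Fin n → R} (hx : eval x P = 0) (hAx : eval x (pderiv i P) ≠ 0)
    (h : SignConnected (pderiv i P) x t) :
    SemialgebraicallyLinked (zeroSet P) x
      (update t i (t i - eval t P / eval t (pderiv i P))) := by
  induction h with
  | refl =>
    rw [hx, zero_div, sub_zero, update_eq_self]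
    exact SemialgebraicallyLinked.refl hx
  | @tail t _ _ hstep ih =>
    obtain ⟨k, v, rfl, hpos⟩ := hstep
    refine ih.trans ?_
    -- `P` is affine in `Xᵢ`, so one Newton step lands on its only zero on the line. Hence a step in
    -- direction `i` does not change the projected point.
    have hproj : ∀ y : Fin n → R, eval y (pderiv i P) ≠ 0 →
        eval (update y i (y i - eval y P / eval y (pderiv i P))) P = 0 := by
      intro y hy
      rw [eval_update_of_mem_multiAffine hP]
      field_simp
      ring
    have ht := hproj t (left_ne_zero_of_mul hpos.ne')
    have ht' := hproj _ (right_ne_zero_of_mul hpos.ne')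
    by_cases hk : k = i
    · subst hk
      convert SemialgebraicallyLinked.refl (S := zeroSet P) ht using 1
      rw [update_idem, update_self, eval_update_pderiv_self hP, eval_update_of_mem_multiAffine hP]
      congr 1
      have := left_ne_zero_of_mul hpos.ne'
      field_simp
      ring
    · refine semialgebraicallyLinked_of_pderiv_mul_pos hP hk ht ht' (fun j h1 h2 => ?_) ?_
        (pderiv_mem_multiAffine hP i)
      · simp [h1, h2]
      · rwa [eval_update_pderiv_self hP, eval_update_pderiv_self hP]

theorem numSemialgebraicComponents_zeroSet_le {P : MvPolynomial (Fin n) R}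
    (hP : P ∈ multiAffine R (d + 1) n) : numSemialgebraicComponents (zeroSet P) ≤ 2 ^ d := by
  classical
  suffices ∃ T : Finset (Fin n → R), T.card ≤ 2 ^ d ∧
      ∀ x ∈ zeroSet P, ∃ t ∈ T, SemialgebraicallyLinked (zeroSet P) x t by
    obtain ⟨T, hT, hcov⟩ := this
    exact (numSemialgebraicComponents_le_card T hcov).trans (by exact_mod_cast hT)
  by_cases hd : ∀ i x, eval x (pderiv i P) = 0
  · refine ⟨{0}, by simpa using Nat.one_le_two_pow, fun x hx => ⟨0, by simp, ?_⟩⟩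
    refine (rel_of_rel_update (r := fun x y => eval x P = 0 →
      SemialgebraicallyLinked (zeroSet P) x y ∧ eval y P = 0)
      (fun x hx => ⟨SemialgebraicallyLinked.refl hx, hx⟩)
      (fun x y z h1 h2 hx => ⟨(h1 hx).1.trans (h2 (h1 hx).2).1, (h2 (h1 hx).2).2⟩)
      (fun x i v hx => ?_) x 0 hx).1
    have h : eval (update x i v) P = 0 := by
      rw [eval_update_of_mem_multiAffine hP, hd, mul_zero, add_zero, hx]
    exact ⟨semialgebraicallyLinked_update hP hx h, h⟩
  · push Not at hd
    obtain ⟨i, z, hz⟩ := hd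
    obtain ⟨T, hT, hcov⟩ := exists_card_le_signConnected (pderiv_mem_multiAffine hP i)
    refine ⟨T.image fun t => update t i (t i - eval t P / eval t (pderiv i P)),
      Finset.card_image_le.trans hT, fun x hx => ?_⟩
    -- All coordinates but `i` are allowed to differ, so `z` is unrestricted.
    obtain ⟨y, h1, h2, h3⟩ := exists_semialgebraicallyLinked_pderiv_ne_zero hP
      (Finset.univ.erase i) (by simp) hx hz (fun j h1 h2 => absurd (by simp [h1]) h2)
    obtain ⟨t, ht, hyt⟩ := hcov y h3
    exact ⟨_, Finset.mem_image_of_mem _ ht, h1.trans (hyt.lift_zeroSet hP h2 h3)⟩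

end ZeroSet

/-! ### Sharpness of the bound -/

section Sharpness

open MvPolynomial

variable {R : Type*} [Field R] {d n : ℕ}

theorem prod_X_sub_one_mem_multiAffine (hdn : d ≤ n) :
    ((∏ i : Fin d, X (Fin.castLE hdn i)) - 1 : MvPolynomial (Fin n) R) ∈ multiAffine R d n := by
  refine ⟨fun i => (degreeOf_sub_le _ _ _).trans (max_le ?_ (by simp)),
    (totalDegree_sub _ _).trans (max_le ?_ (by simp))⟩
  · refine (degreeOf_prod_le _ _ _).trans ?_
    simp only [degreeOf_X]
    rw [Finset.sum_boole]
    refine Finset.card_le_one.mpr fun a ha b hb => Fin.castLE_injective hdn ?_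
    rw [← (Finset.mem_filter.mp ha).2, ← (Finset.mem_filter.mp hb).2]
  · refine (totalDegree_finsetProd _ _).trans ?_
    simp

variable [LinearOrder R] [IsStrictOrderedRing R] [TopologicalSpace R] [OrderTopology R]

/-- A coordinate without zeros on `S` splits any connected subset into two closed pieces by its
sign, one of which must be empty. -/
theorem SemialgebraicallyLinked.mul_apply_pos {S : Set (Fin n → R)} {x y : Fin n → R}
    (h : SemialgebraicallyLinked S x y) {j : Fin n} (hS : ∀ z ∈ S, z j ≠ 0) : 0 < x j * y j := by
  obtain ⟨C, hCS, hC, hx, hy⟩ := h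
  have hcont : Continuous fun z : C => (z : Fin n → R) j :=
    (continuous_apply j).comp continuous_subtype_val
  have hne : ∀ z ∈ C, z j ≠ 0 := fun z hz => hS z (hCS hz)
  have h1 : IsSemialgebraic {z : Fin n → R | 0 ≤ z j} := by
    simpa using IsSemialgebraic.nonneg (X j : MvPolynomial (Fin n) R)
  have h2 : IsSemialgebraic {z : Fin n → R | z j ≤ 0} := by
    simpa using IsSemialgebraic.nonpos (X j : MvPolynomial (Fin n) R)
  have h3 := hC.2 (C ∩ {z | 0 ≤ z j}) (C ∩ {z | z j ≤ 0}) (hC.1.inter h1) (hC.1.inter h2)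
    (by
      rw [← Set.inter_union_distrib_left]
      exact Set.inter_eq_left.mpr fun z _ => le_total 0 (z j))
    (Set.disjoint_left.mpr fun z hz hz' => hne z hz.1 (le_antisymm hz'.2 hz.2))
    (by
      convert isClosed_le (continuous_const (y := (0 : R))) hcont using 1
      ext z
      simp)
    (by
      convert isClosed_le hcont (continuous_const (y := (0 : R))) using 1
      ext z
      simp)
  simp only [Set.eq_empty_iff_forall_notMem, Set.mem_inter_iff, Set.mem_ofPred_eq, not_and,
    not_le] at h3
  rcases h3 with h3 | h3
  · exact mul_pos_of_neg_of_neg (h3 x hx) (h3 y hy)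
  · exact mul_pos (h3 x hx) (h3 y hy)

theorem le_numSemialgebraicComponents_prod_X_sub_one (hdn : d + 1 ≤ n) :
    2 ^ d ≤ numSemialgebraicComponents (zeroSet
      ((∏ i : Fin (d + 1), X (Fin.castLE hdn i)) - 1 : MvPolynomial (Fin n) R)) := by
  set S := zeroSet ((∏ i : Fin (d + 1), X (Fin.castLE hdn i)) - 1 : MvPolynomial (Fin n) R)
    with hS
  have hmem : ∀ z, z ∈ S ↔ ∏ i : Fin (d + 1), z (Fin.castLE hdn i) = 1 := fun z => by
    simp [hS, zeroSet, sub_eq_zero]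
  let sgn : Bool → R := fun b => if b then 1 else -1
  -- The `d` signs are free, the leading coordinate is their product, so that all `d + 1` factors
  -- multiply to 1, and the remaining coordinates are 0. Different sign vectors give different
  -- components.
  let pt : (Fin d → Bool) → Fin n → R := fun ε j =>
    if h : (j : ℕ) < d + 1 then
      (Fin.cons (∏ i, sgn (ε i)) fun i => sgn (ε i) : Fin (d + 1) → R) ⟨j, h⟩ else 0
  have hpt : ∀ ε i, pt ε (Fin.castLE hdn i)
      = (Fin.cons (∏ i, sgn (ε i)) fun i => sgn (ε i) : Fin (d + 1) → R) i := fun ε i => by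
    have h : ((Fin.castLE hdn i : Fin n) : ℕ) < d + 1 := i.2
    simp only [pt, dif_pos h]
    rfl
  have hptS : ∀ ε, pt ε ∈ S := fun ε => by
    rw [hmem]
    simp only [hpt, Fin.prod_univ_succ, Fin.cons_zero, Fin.cons_succ]
    rw [← Finset.prod_mul_distrib]
    refine Finset.prod_eq_one fun i _ => ?_
    cases ε i <;> simp [sgn]
  have hinj : Function.Injective fun ε => semialgebraicComponentIn S (pt ε) := by
    intro ε ε' h
    have hl : SemialgebraicallyLinked S (pt ε) (pt ε') := by
      rw [← mem_semialgebraicComponentIn_iff]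
      simp only at h
      rw [h, mem_semialgebraicComponentIn_iff]
      exact SemialgebraicallyLinked.refl (hptS ε')
    funext i
    have := hl.mul_apply_pos (j := Fin.castLE hdn i.succ) fun z hz h0 => by
      rw [hmem, Finset.prod_eq_zero (Finset.mem_univ i.succ) h0] at hz
      exact zero_ne_one hz
    rw [hpt, hpt, Fin.cons_succ, Fin.cons_succ] at this
    revert this
    cases ε i <;> cases ε' i <;> simp [sgn]
  have hsub : Set.range (fun ε => semialgebraicComponentIn S (pt ε))
      ⊆ semialgebraicComponentIn S '' S := by
    rintro _ ⟨ε, rfl⟩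
    exact ⟨pt ε, hptS ε, rfl⟩
  refine le_trans ?_ (hinj.encard_range.trans (Set.encard_le_encard hsub))
  simp

end Sharpness

theorem theorem2p1 {R : Type*} [Field R] [LinearOrder R] [IsStrictOrderedRing R]
    [IsRealClosed R] [TopologicalSpace R] [OrderTopology R] (d : ℕ) (hd : 1 ≤ d) :
    (∀ (n : ℕ) (P : MvPolynomial (Fin n) R), P ∈ multiAffine R d n →
      numSemialgebraicComponents (zeroSet P) ≤ 2 ^ (d - 1)) ∧
    (∀ (n : ℕ) (hdn : d ≤ n),
      ((∏ i : Fin d, MvPolynomial.X (Fin.castLE hdn i)) - 1 : MvPolynomial (Fin n) R)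
          ∈ multiAffine R d n ∧
        numSemialgebraicComponents
          (zeroSet ((∏ i : Fin d, MvPolynomial.X (Fin.castLE hdn i)) - 1 :
            MvPolynomial (Fin n) R)) = 2 ^ (d - 1)) := by
  obtain ⟨d, rfl⟩ : ∃ m, d = m + 1 := ⟨d - 1, by omega⟩
  rw [Nat.add_sub_cancel]
  exact ⟨fun n P hP => numSemialgebraicComponents_zeroSet_le hP, fun n hdn =>
    ⟨prod_X_sub_one_mem_multiAffine hdn,
      le_antisymm (numSemialgebraicComponents_zeroSet_le (prod_X_sub_one_mem_multiAffine hdn))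
        (le_numSemialgebraicComponents_prod_X_sub_one hdn)⟩⟩
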